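/- Let $S$ be a discrete valuation ring with field of fractions $K$ and maximal ideal generated by $\pi$; let $v$ be the $\pi$-adic valuation, with $v(0)=\infty$. Let $G$ be a finite group acting by automorphisms, $y\mapsto y^\sigma$, on a field $L$ with fixed field $K$, let $N$ be the kernel of the action, and put $g=|G|$, $n=|N|$, $h=[L:K]$, so that $g=nh$. Assume that $n$ is invertible in $K$. Let $T$ be the integral closure of $S$ in $L$. The twisted group ring $L\wr G$ is the right $L$-vector space with basis $G$ and multiplication $(\sigma y)(\tau z)=(\sigma\tau)(y^\tau z)$ for $\sigma,\tau\in G$ and $y,z\in L$, and $T\wr G\subseteq L\wr G$ is the subring of elements with coefficients in $T$. Let $(y_l)_{l}$ be an $S$-linear basis of $T$, let $(y_l^*)_{l}$ be its dual basis, so $\mathrm{Tr}_{L/K}(y_l y_m^*)=\delta_{l,m}$, and let $t\ge 0$ be defined by $S\pi^t=\{z\in S : z y_l^*\in T \text{ for all } l\}$. Let $X$ be a simple right $L\wr G$-module, let $D=\mathrm{End}_{L\wr G}(X)$ be its endomorphism skew field, let $x$ be the dimension of $X$ over $D$, and let $d^2$ be the dimension of $D$ over its center $Z(D)$, with $d \geq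 1$. Then $$v(x)+v(d)\;\le\; v(g)+t .$$ Moreover, $h$ divides $xd$ and the integer $xd/h$ is nonzero in $K$, so that $\frac{g}{xd}=\frac{n}{xd/h}$ is a well-defined element of $K$ (even if $h=0$ in $K$); the bound holds in the form $$v(xd/h)\;\le\; v(n)+t ;$$ there is exactly one primitive central idempotent $\varepsilon$ of $L\wr G$ that acts on $X$ as the identity; and $$\frac{\pi^t g}{xd}\,\varepsilon\;\in\; T\wr G .$$ -/

import Mathlib

/-- The twisted group ring `L ≀ G` of a group `G` acting by automorphisms on a field `L`.

Writing the action exponentially from the right, `y ^ τ = τ⁻¹ • y`, the element `σ y` (with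
`σ ∈ G`, `y ∈ L`) is `single σ (σ • y)`, and the element `y σ` is `single σ y`. The product
`single σ a * single τ b = single (σ * τ) (a * σ • b)` is then the usual rule
`(σ y) (τ z) = (σ τ) (y ^ τ z)`. -/
abbrev TwistedGroupRing (L G : Type*) [Field L] [Group G] [MulSemiringAction G L] :=
  SkewMonoidAlgebra L G

/-- The subset `T ≀ G` of `L ≀ G`, where `T` is the integral closure of `S` in `L`: the elements
all of whose coefficients lie in `T`. As `T` is stable under the automorphisms in `G` (these are
`S`-linear when `S` lies in the fixed field), it does not matter whether the coefficients are
written to the left or to the right of the group elements. -/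
def integralTwistedGroupRing (S L G : Type*) [CommRing S] [Field L] [Algebra S L] [Group G]
    [MulSemiringAction G L] : Submodule S (TwistedGroupRing L G) where
  carrier := {a | ∀ σ : G, a.coeff σ ∈ integralClosure S L}
  zero_mem' := fun σ => by
    simp
  add_mem' := fun {a b} ha hb σ => by
    simpa using (integralClosure S L).add_mem (ha σ) (hb σ)
  smul_mem' := fun s a ha σ => by
    simpa using (integralClosure S L).smul_mem (ha σ) s

/-- The order `n` of the kernel `N` of the action of `G` on `L`. -/
noncomputable def kernelOrder (L G : Type*) [Field L] [Group G] [MulSemiringAction G L] : ℕ :=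
  Nat.card (MulSemiringAction.toRingAut G L).ker

/-- The skew field `End X` of a right module `X` over a ring `A`. -/
abbrev EndRight (A X : Type*) [Ring A] [AddCommGroup X] [Module Aᵐᵒᵖ X] :=
  Module.End Aᵐᵒᵖ X

/-- The dimension of a right `A`-module over its endomorphism ring. -/
noncomputable def dimOverEnd (A X : Type*) [Ring A] [AddCommGroup X] [Module Aᵐᵒᵖ X] : ℕ :=
  Module.finrank (EndRight A X) X

/-- The degree `d` of a skew field `D` of finite dimension over its center `Z(D)`; this dimension
is `d ^ 2`. -/
noncomputable def skewFieldDegree (D : Type*) [Ring D] : ℕ :=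
  Nat.sqrt (Module.finrank (Subring.center D) D)

/-- `ε` is a primitive idempotent of the center of the ring `A`. -/
structure IsCentralPrimitiveIdempotent {A : Type*} [Ring A] (ε : A) : Prop where
  mem_center : ε ∈ Subring.center A
  idempotent : ε * ε = ε
  ne_zero : ε ≠ 0
  primitive : ∀ e ∈ Subring.center A, e * e = e → ε * e = 0 ∨ ε * e = ε

/-- The primitive central idempotent `ε` of `A` belongs to the right `A`-module `X`, i.e. it
acts on `X` as the identity. -/
structure IsCentralPrimitiveIdempotentOf {A : Type*} [Ring A] (X : Type*) [AddCommGroup X]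
    [Module Aᵐᵒᵖ X] (ε : A) : Prop where
  isCentralPrimitiveIdempotent : IsCentralPrimitiveIdempotent ε
  acts_as_one : ∀ x : X, MulOpposite.op ε • x = x

/-! Write `A = L ≀ G` and let `f(a)` be the trace of the coefficient of `a` at `1`. Right
`A`-modules are handled as left modules over the opposite ring. The form `f` is symmetric, and `σ
y_l`, `y_l^* σ⁻¹` are dual families `p`, `q` for it, with `∑ p w q = n Tr(w)` for `w ∈ L`. As `n` is
invertible, some `w` makes this sum `1`; averaging then produces the central idempotent `ε` of `X`
(`exists_central_idempotent`).

The trace of `p ↦ a p w ε` on the opposite ring is computed twice. Dual families give `n Tr(w) f(a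
ε)`. On the other hand it is a trace on `End_D X`, which becomes a matrix algebra of size `x d` over
an algebraically closed `Ω ⊇ Z(D)`; with the resulting character `χ` the trace is `Tr_{Z(D)/K}(χ(a)
χ(w))` (`exists_character_of_isSimpleModule`). On `L`, `χ = r Tr` with `x d = h r`, since `G`
permutes the embeddings of `L` transitively (`exists_multiplicity_of_conjugate`).

Choosing `Tr(w) = 1/r` gives `(n/r) f(a ε) = Tr_{Z(D)/K} χ(a)`. For `a = σ z` with `z ∈ T` this is
integral, because a power of `a` lies in `T`. Expanding `ε` in the dual family puts `π^t (n/r) ε` in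
`T ≀ G`, and by `isIntegral_of_smul_idempotent_mem` this forces `r ∣ π^t n` in `S`. Working with `r`
instead of `x d` avoids division by `h`, which may vanish in `K`. -/

/-! ### Splitting of central simple algebras. -/

section CentralSimple

open scoped TensorProduct

variable (Z E : Type*) [Field Z] [Ring E] [Algebra Z E]

/-- For a central simple algebra, every linear endomorphism is a sum of two-sided
multiplications. -/
theorem mulLeftRight_surjective [IsSimpleRing E] [Algebra.IsCentral Z E] [FiniteDimensional Z E] :
    Function.Surjective (AlgHom.mulLeftRight Z E) := by
  let : Module (E ⊗[Z] Eᵐᵒᵖ) E := TensorProduct.Algebra.module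
  have key : ∀ (t : E ⊗[Z] Eᵐᵒᵖ) (e : E), t • e = AlgHom.mulLeftRight Z E t e := fun _ _ => rfl
  have hlr : ∀ a b e : E, (a ⊗ₜ[Z] MulOpposite.op b) • e = a * e * b := fun a b e => by
    rw [key, AlgHom.mulLeftRight_apply]; rfl
  have : IsScalarTower Z (E ⊗[Z] Eᵐᵒᵖ) E := ⟨fun r t e => by
    rw [key, key, map_smul]; rfl⟩
  have : IsSimpleModule (E ⊗[Z] Eᵐᵒᵖ) E := by
    have hsimple : ∀ N : Submodule (E ⊗[Z] Eᵐᵒᵖ) E, N = ⊥ ∨ N = ⊤ := by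
      intro N
      let I : TwoSidedIdeal E := TwoSidedIdeal.mk' (N : Set E) N.zero_mem N.add_mem N.neg_mem
        (fun {a b} hb => by
          have := N.smul_mem (a ⊗ₜ[Z] MulOpposite.op 1) hb
          rwa [hlr, mul_one] at this)
        (fun {a b} ha => by simpa [hlr] using N.smul_mem ((1 : E) ⊗ₜ[Z] MulOpposite.op b) ha)
      have hI : ∀ a, a ∈ I ↔ a ∈ N := fun a => TwoSidedIdeal.mem_mk' ..
      rcases eq_bot_or_eq_top I with h | h
      · left
        ext a
        rw [← hI, h]; simp [TwoSidedIdeal.mem_bot]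
      · right
        ext a
        rw [← hI, h]; simp
    exact { eq_bot_or_eq_top := hsimple }
  intro T
  -- Bimodule endomorphisms of `E` are multiplications by central elements, that is by `Z`. So every
  -- `Z`-linear `T` commutes with them, and the density theorem realizes `T` on a spanning set.
  have hend : ∀ φ : Module.End (E ⊗[Z] Eᵐᵒᵖ) E, ∃ z : Z, ∀ e, φ e = z • e := by
    intro φ
    have hl : ∀ e, φ e = e * φ 1 := fun e => by
      have := φ.map_smul (e ⊗ₜ[Z] MulOpposite.op 1) 1
      rwa [hlr, hlr, mul_one, mul_one, mul_one] at this
    have hr : ∀ e, φ e = φ 1 * e := fun e => by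
      simpa [hlr] using φ.map_smul ((1 : E) ⊗ₜ[Z] MulOpposite.op e) 1
    have hc : φ 1 ∈ Subalgebra.center Z E := by
      rw [Subalgebra.mem_center_iff]
      intro b
      rw [← hl, hr]
    obtain ⟨z, hz⟩ := (Algebra.IsCentral.mem_center_iff Z).1 hc
    exact ⟨z, fun e => by rw [hr, hz, Algebra.smul_def]⟩
  let T' : Module.End (Module.End (E ⊗[Z] Eᵐᵒᵖ) E) E :=
    { toFun := T
      map_add' := T.map_add
      map_smul' := fun φ e => by
        obtain ⟨z, hz⟩ := hend φ
        simp only [Module.End.smul_def, hz, map_smul, RingHom.id_apply] }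
  obtain ⟨s, hs⟩ := Module.Finite.fg_top (R := Z) (M := E)
  obtain ⟨r, hr⟩ := jacobson_density T' s
  refine ⟨r, LinearMap.ext_on hs fun m hm => ?_⟩
  exact (hr m hm).symm

/-- A central simple algebra stays simple under extension of the ground field. -/
theorem isSimpleRing_baseChange (Ω : Type*) [Field Ω] [Algebra Z Ω] [IsSimpleRing E]
    [Algebra.IsCentral Z E] [FiniteDimensional Z E] : IsSimpleRing (Ω ⊗[Z] E) := by
  have : Nontrivial (Ω ⊗[Z] E) := inferInstance
  refine ⟨{ toNontrivial := inferInstance, eq_bot_or_eq_top := fun I => ?_ }⟩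
  by_cases hI : ∀ x ∈ I, x = 0
  · left
    ext x
    refine ⟨fun hx => by simpa using hI x hx, fun hx => ?_⟩
    rw [TwoSidedIdeal.mem_bot] at hx
    rw [hx]; exact I.zero_mem
  right
  push Not at hI
  obtain ⟨x, hx, hx0⟩ := hI
  have hstab : ∀ T : Module.End Z E, LinearMap.lTensor Ω T x ∈ I := by
    intro T
    obtain ⟨t, rfl⟩ := mulLeftRight_surjective Z E T
    induction t using TensorProduct.induction_on with
    | zero => simp
    | add t s ht hs => simpa [LinearMap.lTensor_add] using I.add_mem ht hs
    | tmul a b =>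
      have : LinearMap.lTensor Ω (AlgHom.mulLeftRight Z E (a ⊗ₜ[Z] b)) x
          = ((1 : Ω) ⊗ₜ[Z] a) * x * ((1 : Ω) ⊗ₜ[Z] b.unop) := by
        clear hx hx0
        induction x using TensorProduct.induction_on with
        | zero => simp
        | add t s ht hs => rw [map_add, ht, hs, mul_add, add_mul]
        | tmul ω e => simp [Algebra.TensorProduct.tmul_mul_tmul]
      rw [this]
      exact I.mul_mem_right _ _ (I.mul_mem_left _ _ hx)
  let b := Module.finBasis Z E
  let B := b.baseChange Ω
  -- Applying a coordinate functional of `E` with nonzero value on `x` moves `x` to some `ω ⊗ 1`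
  -- with `ω ≠ 0`, a unit in `I`.
  obtain ⟨i, hi⟩ : ∃ i, B.repr x i ≠ 0 := by
    by_contra! h
    exact hx0 (B.repr.injective (by ext i; simp [h i]))
  have hfun : ∀ y : Ω ⊗[Z] E,
      LinearMap.lTensor Ω ((b.coord i).smulRight (1 : E)) y = (B.repr y i) ⊗ₜ[Z] (1 : E) := by
    intro y
    induction y using TensorProduct.induction_on with
    | zero => simp
    | add t s ht hs => rw [map_add, ht, hs, map_add, Finsupp.add_apply, TensorProduct.add_tmul]
    | tmul ω e =>
      simp [B, Module.Basis.baseChange_repr_tmul, TensorProduct.tmul_smul, TensorProduct.smul_tmul']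
  have h1 := hstab ((b.coord i).smulRight (1 : E))
  rw [hfun] at h1
  have h2 := I.mul_mem_left ((B.repr x i)⁻¹ ⊗ₜ[Z] (1 : E)) _ h1
  rw [Algebra.TensorProduct.tmul_mul_tmul, inv_mul_cancel₀ hi, mul_one,
    ← Algebra.TensorProduct.one_def] at h2
  exact (TwoSidedIdeal.one_mem_iff I).1 h2

/-- A central simple algebra is split by any algebraically closed extension field. -/
theorem exists_splitting_of_isCentral (Ω : Type*) [Field Ω] [IsAlgClosed Ω] [Algebra Z Ω]
    [IsSimpleRing E] [Algebra.IsCentral Z E] [FiniteDimensional Z E] :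
    ∃ m : ℕ, m ^ 2 = Module.finrank Z E ∧
      Nonempty (Ω ⊗[Z] E ≃ₐ[Ω] Matrix (Fin m) (Fin m) Ω) := by
  have := isSimpleRing_baseChange Z E Ω
  obtain ⟨m, _, ⟨e⟩⟩ := IsSimpleRing.exists_algEquiv_matrix_of_isAlgClosed Ω (Ω ⊗[Z] E)
  refine ⟨m, ?_, ⟨e⟩⟩
  have := e.toLinearEquiv.finrank_eq
  rw [Module.finrank_baseChange, Module.finrank_matrix] at this
  simp at this
  rw [this, sq]

/-- The dimension of the endomorphism algebra of a finite-dimensional vector space over a skew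
field. -/
theorem finrank_end_of_divisionRing (D X : Type*) [DivisionRing D] [Algebra Z D]
    [AddCommGroup X] [Module D X] [Module Z X] [IsScalarTower Z D X] [SMulCommClass D Z X]
    [Module.Finite D X] :
    Module.finrank Z (Module.End D X) = Module.finrank D X ^ 2 * Module.finrank Z D := by
  let e : X ≃ₗ[D] (Fin (Module.finrank D X) → D) := (Module.finBasis D X).equivFun
  let E := (e.conjAlgEquiv Z).trans ((endVecAlgEquivMatrixEnd (Fin (Module.finrank D X)) Z D D).trans
    (AlgEquiv.moduleEndSelf Z (A := D)).symm.mapMatrix)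
  rw [E.toLinearEquiv.finrank_eq, Module.finrank_matrix, (MulOpposite.opLinearEquiv Z).symm.finrank_eq]
  simp [sq]

theorem isSimpleRing_end_of_divisionRing (D X : Type*) [DivisionRing D]
    [AddCommGroup X] [Module D X] [Module.Finite D X] [Nontrivial X] :
    IsSimpleRing (Module.End D X) := by
  let e : X ≃ₗ[D] (Fin (Module.finrank D X) → D) := (Module.finBasis D X).equivFun
  have : Nonempty (Fin (Module.finrank D X)) := ⟨⟨0, Module.finrank_pos⟩⟩
  let E : Module.End D X ≃+* Matrix _ _ Dᵐᵒᵖ :=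
    (e.conjRingEquiv).trans ((endVecRingEquivMatrixEnd (Fin (Module.finrank D X)) D D).trans
    (RingEquiv.moduleEndSelf D).symm.mapMatrix)
  exact IsSimpleRing.of_ringEquiv E.symm inferInstance

end CentralSimple

universe u

/-! ### Traces of two-sided multiplications. -/

section Traces

open scoped TensorProduct

theorem trace_restrictScalars_eq (K Z M : Type*) [Field K] [Field Z] [Algebra K Z]
    [FiniteDimensional K Z] [AddCommGroup M] [Module K M] [Module Z M] [IsScalarTower K Z M]
    [FiniteDimensional Z M] (f : M →ₗ[Z] M) :
    LinearMap.trace K M (f.restrictScalars K) = Algebra.trace K Z (LinearMap.trace Z M f) := by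
  classical
  let b := Module.finBasis K Z
  let c := Module.finBasis Z M
  rw [LinearMap.trace_eq_matrix_trace K (b.smulTower' c),
    LinearMap.trace_eq_matrix_trace Z c, Matrix.trace, Matrix.trace, map_sum,
    ← Finset.univ_product_univ, Finset.sum_product]
  refine Finset.sum_congr rfl fun i _ => ?_
  rw [Algebra.trace_eq_matrix_trace b, Matrix.trace]
  refine Finset.sum_congr rfl fun j _ => ?_
  simp [LinearMap.toMatrix_apply, Algebra.leftMulMatrix_eq_repr_mul, mul_comm,
    Module.Basis.smulTower'_repr, Module.Basis.smulTower'_apply]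

/-- The matrix unit at `(i, j)` contributes `A i i * B j j` to the trace. -/
theorem trace_matrix_mulLeftRight {m Ω : Type*} [Fintype m] [DecidableEq m] [Field Ω]
    (A B : Matrix m m Ω) :
    LinearMap.trace Ω (Matrix m m Ω) (LinearMap.mulLeftRight Ω (A, B)) = A.trace * B.trace := by
  rw [LinearMap.trace_eq_matrix_trace Ω (Matrix.stdBasis Ω m m), Matrix.trace,
    ← Finset.univ_product_univ, Finset.sum_product, Matrix.trace, Matrix.trace,
    Finset.sum_mul_sum]
  refine Finset.sum_congr rfl fun i _ => Finset.sum_congr rfl fun j _ => ?_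
  rw [Matrix.diag_apply, LinearMap.toMatrix_apply, Matrix.stdBasis_eq_single]
  simp [Matrix.stdBasis, Matrix.mul_apply, Matrix.single, ite_and]

/-- A split form of a central simple algebra computes the traces of two-sided multiplications. -/
theorem exists_split_representation (Z E Ω : Type*) [Field Z] [Ring E] [Algebra Z E]
    [IsSimpleRing E] [Algebra.IsCentral Z E] [FiniteDimensional Z E]
    [Field Ω] [IsAlgClosed Ω] [Algebra Z Ω] :
    ∃ (m : ℕ) (ρ : E →ₐ[Z] Matrix (Fin m) (Fin m) Ω), m ^ 2 = Module.finrank Z E ∧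
      ∀ a b : E, algebraMap Z Ω (LinearMap.trace Z E (LinearMap.mulLeftRight Z (a, b)))
        = (ρ a).trace * (ρ b).trace := by
  obtain ⟨m, hm, ⟨e⟩⟩ := exists_splitting_of_isCentral Z E Ω
  refine ⟨m, (e.toAlgHom.restrictScalars Z).comp Algebra.TensorProduct.includeRight, hm,
    fun a b => ?_⟩
  rw [← LinearMap.trace_baseChange, ← trace_matrix_mulLeftRight,
    ← LinearMap.trace_conj' _ e.toLinearEquiv]
  congr 1
  have h : (LinearMap.mulLeftRight Z (a, b)).baseChange Ω
      = LinearMap.mulLeftRight Ω ((1 : Ω) ⊗ₜ[Z] a, (1 : Ω) ⊗ₜ[Z] b) := by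
    refine TensorProduct.AlgebraTensorModule.ext fun ω x => ?_
    simp [Algebra.TensorProduct.tmul_mul_tmul]
  rw [h, AlgEquiv.linearEquivConj_mulLeftRight]
  rfl

end Traces

section EndOfVectorSpace

/-- The endomorphism algebra of a finite-dimensional vector space over a skew field `D` has a
representation of degree `x d` whose character computes, over the center of `D`, the traces of
two-sided multiplications. -/
theorem exists_character_end (K : Type*) (D : Type u) (X : Type*) [Field K] [DivisionRing D] [Algebra K D]
    [FiniteDimensional K D] [AddCommGroup X] [Nontrivial X] [Module D X] [Module K X]
    [IsScalarTower K D X] [Module.Finite D X] [SMulCommClass D K X] :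
    ∃ (Z Ω : Type u) (_ : Field Z) (_ : Field Ω) (_ : Algebra K Z) (_ : FiniteDimensional K Z)
      (_ : Algebra Z Ω) (_ : Algebra K Ω) (_ : IsScalarTower K Z Ω) (_ : IsAlgClosed Ω)
      (ρ : Module.End D X →ₐ[K]
        Matrix (Fin (Module.finrank D X * skewFieldDegree D))
          (Fin (Module.finrank D X * skewFieldDegree D)) Ω),
      ∀ a b : Module.End D X, ∃ z : Z,
        algebraMap Z Ω z = (ρ a).trace * (ρ b).trace ∧
        Algebra.trace K Z z =
          LinearMap.trace K (Module.End D X) (LinearMap.mulLeftRight K (a, b)) := by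
  let Z := Subring.center D
  let Ω := AlgebraicClosure Z
  let algKZ : Algebra K Z := ((algebraMap K D).codRestrict Z fun k =>
    Subring.mem_center_iff.2 fun d => (Algebra.commutes k d).symm).toAlgebra
  have : IsScalarTower K Z D := .of_algebraMap_eq fun _ => rfl
  have : FiniteDimensional K Z := FiniteDimensional.of_injective
    (IsScalarTower.toAlgHom K Z D).toLinearMap Subtype.val_injective
  have : FiniteDimensional Z D := FiniteDimensional.right K Z D
  have : SMulCommClass D Z X := ⟨fun d z v => by
    change d • (z : D) • v = (z : D) • d • v
    rw [smul_smul, smul_smul, Subring.mem_center_iff.1 z.2 d]⟩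
  have : IsScalarTower K Z X := ⟨fun k z v => by
    rw [Algebra.smul_def, mul_smul]
    exact algebraMap_smul D k (z • v)⟩
  have : IsScalarTower K Z (Module.End D X) := ⟨fun k z φ => by
    ext v
    simp⟩
  have : Algebra.IsCentral Z D := ⟨fun d hd => by
    rw [Subalgebra.mem_center_iff] at hd
    exact Algebra.mem_bot.2 ⟨⟨d, Subring.mem_center_iff.2 hd⟩, rfl⟩⟩
  have : IsSimpleRing (Module.End D X) := isSimpleRing_end_of_divisionRing D X
  have hfin := finrank_end_of_divisionRing Z D X
  have : FiniteDimensional Z (Module.End D X) := by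
    apply FiniteDimensional.of_finrank_pos
    rw [hfin]
    have := Module.finrank_pos (R := D) (M := X)
    have := Module.finrank_pos (R := Z) (M := D)
    positivity
  obtain ⟨m, ρ, hm, hρ⟩ := exists_split_representation Z (Module.End D X) Ω
  have hmx : m = Module.finrank D X * skewFieldDegree D := by
    rw [hfin] at hm
    have hx := Module.finrank_pos (R := D) (M := X)
    -- From `m ^ 2 = x ^ 2 [D : Z]` it follows that `x ∣ m` and that `[D : Z]` is a perfect square,
    -- so the `Nat.sqrt` in `skewFieldDegree` is exact.
    obtain ⟨d, rfl⟩ : Module.finrank D X ∣ m :=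
      (Nat.pow_dvd_pow_iff two_ne_zero).1 (hm ▸ Dvd.intro _ rfl)
    rw [mul_pow] at hm
    have := Nat.eq_of_mul_eq_mul_left (pow_pos hx 2) hm
    have h2 : skewFieldDegree D = d := by
      unfold skewFieldDegree
      rw [← Nat.sqrt_eq' d, this]
    rw [h2]
  subst hmx
  refine ⟨Z, Ω, inferInstance, inferInstance, algKZ, inferInstance, inferInstance, inferInstance,
    inferInstance, inferInstance, ρ.restrictScalars K, fun a b => ⟨_, hρ a b, ?_⟩⟩
  rw [← trace_restrictScalars_eq]
  rfl

end EndOfVectorSpace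

/-! ### Symmetric algebras and dual families. -/

section SymmetricAlgebra

variable {K R ι : Type*} [Field K] [Ring R] [Algebra K R] [Fintype ι]

/-- Two families of elements of an algebra that are dual to each other with respect to a symmetric
linear form `f`, expressed by the expansions of the elements of the algebra. -/
structure IsDualFamily (f : R →ₗ[K] K) (p q : ι → R) : Prop where
  symm : ∀ a b, f (a * b) = f (b * a)
  expand_left : ∀ a, ∑ i, f (a * q i) • p i = a
  expand_right : ∀ a, ∑ i, f (p i * a) • q i = a

namespace IsDualFamily

variable {f : R →ₗ[K] K} {p q : ι → R}

/-- The Casimir tensor `∑ p i ⊗ q i` turns left multiplication on the first factor into right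
multiplication on the second: both sides have the coefficients `f (a * p i * q j)`. -/
theorem sum_mul_left (h : IsDualFamily f p q) {M : Type*} [AddCommGroup M] [Module K M]
    (B : R →ₗ[K] R →ₗ[K] M) (a : R) : ∑ i, B (a * p i) (q i) = ∑ i, B (p i) (q i * a) := by
  have h1 : ∀ i, B (a * p i) (q i) = ∑ j, f (a * p i * q j) • B (p j) (q i) := fun i => by
    conv_lhs => rw [← h.expand_left (a * p i)]
    simp
  have h2 : ∀ j, B (p j) (q j * a) = ∑ i, f (a * p i * q j) • B (p j) (q i) := fun j => by
    conv_lhs => rw [← h.expand_right (q j * a)]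
    simp only [map_sum, map_smul]
    refine Finset.sum_congr rfl fun i _ => ?_
    rw [mul_assoc, h.symm a, mul_assoc]
  simp_rw [h1, h2]
  exact Finset.sum_comm

/-- The dual family writes `F` as a sum of the rank-one maps `a ↦ f (a * q i) • F (p i)`. -/
theorem trace_eq (h : IsDualFamily f p q) [FiniteDimensional K R] (F : R →ₗ[K] R) :
    LinearMap.trace K R F = ∑ i, f (F (p i) * q i) := by
  have hF : F = ∑ i, (f ∘ₗ LinearMap.mulRight K (q i)).smulRight (F (p i)) := by
    ext a
    conv_lhs => rw [← h.expand_left a]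
    simp [LinearMap.sum_apply]
  conv_lhs => rw [hF]
  simp

/-- In a separable symmetric algebra, every two-sided ideal is generated by a central idempotent.
-/
theorem exists_central_idempotent (h : IsDualFamily f p q) {w : R}
    (hw : ∑ i, p i * w * q i = 1) (I : Submodule K R) (hl : ∀ a, ∀ b ∈ I, a * b ∈ I)
    (hr : ∀ a, ∀ b ∈ I, b * a ∈ I) :
    ∃ e ∈ I, (∀ a, a * e = e * a) ∧ ∀ a ∈ I, a * e = a := by
  obtain ⟨pr, hpr⟩ := I.subtype.exists_leftInverse_of_injective I.ker_subtype
  let π : R →ₗ[K] R := I.subtype ∘ₗ pr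
  have hπ : ∀ a ∈ I, π a = a := fun a ha => by
    have := LinearMap.congr_fun hpr ⟨a, ha⟩
    simpa [π] using congrArg Subtype.val this
  have hπI : ∀ a, π a ∈ I := fun a => (pr a).2
  -- The projection `π` onto `I` is averaged on both sides. The Casimir identity makes `P` a
  -- bimodule map, and `hw` makes it the identity on `I`; hence `P 1` is the idempotent sought.
  let P : R → R := fun x => ∑ i, ∑ j, p i * π (w * q i * x * (p j * w)) * q j
  have hPl : ∀ a x, a * P x = P (a * x) := by
    intro a x
    simp only [P, Finset.mul_sum]
    refine Finset.sum_comm.trans ((Finset.sum_congr rfl fun j _ => ?_).trans Finset.sum_comm)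
    have := h.sum_mul_left ((LinearMap.mul K R).compl₂
      (LinearMap.mulRight K (q j) ∘ₗ π ∘ₗ LinearMap.mulRight K (x * (p j * w)) ∘ₗ
        LinearMap.mulLeft K w)) a
    simpa [mul_assoc] using this
  have hPr : ∀ a x, P x * a = P (x * a) := by
    intro a x
    simp only [P, Finset.sum_mul]
    refine Finset.sum_congr rfl fun i _ => ?_
    have := h.sum_mul_left (LinearMap.mul K R ∘ₗ LinearMap.mulLeft K (p i) ∘ₗ π ∘ₗ
      LinearMap.mulLeft K (w * q i * x) ∘ₗ LinearMap.mulRight K w) a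
    simpa [mul_assoc] using this.symm
  have hPI : ∀ a ∈ I, P a = a := by
    intro a ha
    have h1 : ∀ i j, p i * π (w * q i * a * (p j * w)) * q j
        = (p i * w * q i) * a * (p j * w * q j) := fun i j => by
      rw [hπ _ (hr _ _ (hl _ _ ha))]
      simp only [mul_assoc]
    simp only [P, h1]
    simp_rw [← Finset.mul_sum, hw, mul_one, ← Finset.sum_mul, hw, one_mul]
  refine ⟨P 1, I.sum_mem fun i _ => I.sum_mem fun j _ => hr _ _ (hl _ _ (hπI _)), fun a => ?_,
    fun a ha => ?_⟩
  · rw [hPl, hPr, mul_one, one_mul]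
  · rw [hPl, mul_one, hPI a ha]

/-- The central idempotent that belongs to a module over a separable symmetric algebra. -/
theorem exists_central_idempotent_of_module (h : IsDualFamily f p q) {w : R}
    (hw : ∑ i, p i * w * q i = 1) (X : Type*) [AddCommGroup X] [Module R X] :
    ∃ ε : R, (∀ a, a * ε = ε * a) ∧ (∀ v : X, ε • v = v) ∧
      ∀ a : R, (∀ v : X, a • v = 0) → a * ε = 0 := by
  let I : Submodule K R :=
    { carrier := {a | ∀ v : X, a • v = 0}
      zero_mem' := fun v => zero_smul R v
      add_mem' := fun {a b} ha hb v => by rw [add_smul, ha v, hb v, add_zero]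
      smul_mem' := fun k a ha v => by rw [Algebra.smul_def, mul_smul, ha v, smul_zero] }
  obtain ⟨e, he, hc, hI⟩ := h.exists_central_idempotent hw I
    (fun a b hb v => by rw [mul_smul, hb v, smul_zero])
    (fun a b hb v => by rw [mul_smul, hb (a • v)])
  refine ⟨1 - e, fun a => by rw [mul_sub, sub_mul, hc, mul_one, one_mul], fun v => ?_,
    fun a ha => ?_⟩
  · rw [sub_smul, he v, one_smul, sub_zero]
  · rw [mul_sub, mul_one, hI a ha, sub_self]

end IsDualFamily

/-- Traces can be computed on a quotient if the endomorphism vanishes on the kernel. -/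
theorem trace_eq_of_surjective {V W : Type*} [AddCommGroup V] [Module K V] [AddCommGroup W]
    [Module K W] [FiniteDimensional K V] [FiniteDimensional K W] (ψ : V →ₗ[K] W)
    (hψ : Function.Surjective ψ) (F : V →ₗ[K] V) (F' : W →ₗ[K] W) (h : ψ ∘ₗ F = F' ∘ₗ ψ)
    (h0 : ∀ v, ψ v = 0 → F v = 0) : LinearMap.trace K V F = LinearMap.trace K W F' := by
  obtain ⟨s, hs⟩ := ψ.exists_rightInverse_of_surjective (LinearMap.range_eq_top.2 hψ)
  have hs' : ∀ y, ψ (s y) = y := fun y => LinearMap.congr_fun hs y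
  have hF : F = (F ∘ₗ s) ∘ₗ ψ := by
    ext v
    have := h0 (v - s (ψ v)) (by rw [map_sub, hs', sub_self])
    rw [map_sub, sub_eq_zero] at this
    exact this
  rw [hF, LinearMap.trace_comp_comm', ← LinearMap.comp_assoc, h, LinearMap.comp_assoc, hs,
    LinearMap.comp_id]

/-- A simple module of a finite-dimensional algebra `R` gives rise to a representation of `R` of
degree `x d` over an algebraically closed field, the character of which computes the traces of
two-sided multiplications on the component of `R`. -/
theorem exists_character_of_isSimpleModule [FiniteDimensional K R] (X : Type u) [AddCommGroup X]
    [Module R X] [IsSimpleModule R X] {ε : R} (hε : ∀ a, a * ε = ε * a)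
    (hεX : ∀ v : X, ε • v = v) (hε0 : ∀ a : R, (∀ v : X, a • v = 0) → a * ε = 0) :
    ∃ (Z Ω : Type u) (_ : Field Z) (_ : Field Ω) (_ : Algebra K Z) (_ : FiniteDimensional K Z)
      (_ : Algebra Z Ω) (_ : Algebra K Ω) (_ : IsScalarTower K Z Ω) (_ : IsAlgClosed Ω)
      (ρ : R →ₐ[K]
        Matrix (Fin (Module.finrank (Module.End R X) X * skewFieldDegree (Module.End R X)))
          (Fin (Module.finrank (Module.End R X) X * skewFieldDegree (Module.End R X))) Ω),
      ∀ a b : R, ∃ z : Z,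
        algebraMap Z Ω z = (ρ a).trace * (ρ b).trace ∧
        Algebra.trace K Z z = LinearMap.trace K R (LinearMap.mulLeftRight K (a, b * ε)) := by
  classical
  let : Module K X := Module.compHom X (algebraMap K R)
  have : IsScalarTower K R X := ⟨fun k a v => by
    rw [Algebra.smul_def, mul_smul]; rfl⟩
  have : SMulCommClass R K X := IsScalarTower.to_smulCommClass'
  have : Module.Finite R X := inferInstance
  have : Module.Finite K X := Module.Finite.trans R X
  have : Nontrivial X := IsSimpleModule.nontrivial R X
  have : FiniteDimensional K (Module.End R X) := by
    let φ : Module.End R X →ₗ[K] Module.End K X :=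
      { toFun := fun φ => φ.restrictScalars K
        map_add' := fun _ _ => rfl
        map_smul' := fun _ _ => rfl }
    exact FiniteDimensional.of_injective φ (LinearMap.restrictScalars_injective K)
  have : IsScalarTower K (Module.End R X) X := ⟨fun k φ v => rfl⟩
  have : SMulCommClass (Module.End R X) K X := ⟨fun φ k v => by
    simp only [Module.End.smul_def]
    exact (φ.restrictScalars K).map_smul k v⟩
  have : Module.Finite (Module.End R X) X := Module.Finite.of_restrictScalars_finite K _ X
  obtain ⟨Z, Ω, _, _, _, _, _, _, _, _, ρ, hρ⟩ := exists_character_end K (Module.End R X) X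
  let ψ : R →ₐ[K] Module.End (Module.End R X) X :=
    { Module.toModuleEnd (Module.End R X) (S := R) X with
      commutes' := fun k => by
        ext v
        exact algebraMap_smul R k v }
  -- By density `R` maps onto `End_D X`. Multiplication by `ε` kills the kernel, so the trace on `R`
  -- reduces to one on `End_D X`.
  have hψ : Function.Surjective ψ := Module.Finite.toModuleEnd_moduleEnd_surjective
  have hψ0 : ∀ a, ψ a = 0 → ∀ v : X, a • v = 0 := fun a ha v => LinearMap.congr_fun ha v
  have hψε : ψ ε = 1 := LinearMap.ext hεX
  have : FiniteDimensional K (Module.End (Module.End R X) X) :=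
    Module.Finite.of_surjective ψ.toLinearMap hψ
  refine ⟨Z, Ω, inferInstance, inferInstance, inferInstance, inferInstance, inferInstance,
    inferInstance, inferInstance, inferInstance, ρ.comp ψ, fun a b => ?_⟩
  obtain ⟨z, hz, hz'⟩ := hρ (ψ a) (ψ b)
  refine ⟨z, hz, hz'.trans (trace_eq_of_surjective ψ.toLinearMap hψ _ _ ?_ fun v hv => ?_).symm⟩
  · ext v : 1
    simp [hψε, mul_assoc]
  · have := hε0 v (hψ0 v hv)
    simp only [LinearMap.mulLeftRight_apply, mul_assoc, hε b]
    rw [← mul_assoc v, this, zero_mul, mul_zero]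

end SymmetricAlgebra

/-! ### Central primitive idempotents of simple modules. -/

section CentralIdempotent

/-- The central primitive idempotent of a simple right module is characterized by acting as the
identity and annihilating the annihilator of the module. -/
theorem isCentralPrimitiveIdempotentOf_iff {A : Type*} [Ring A] (X : Type*) [AddCommGroup X]
    [Module Aᵐᵒᵖ X] [IsSimpleModule Aᵐᵒᵖ X] {e : Aᵐᵒᵖ} (he : ∀ a, a * e = e * a)
    (heX : ∀ v : X, e • v = v) (he0 : ∀ a : Aᵐᵒᵖ, (∀ v : X, a • v = 0) → a * e = 0) (ε : A) :
    IsCentralPrimitiveIdempotentOf X ε ↔ ε = e.unop := by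
  have hnt : Nontrivial X := IsSimpleModule.nontrivial Aᵐᵒᵖ X
  have hc : ∀ b : A, b * e.unop = e.unop * b := fun b =>
    (MulOpposite.op_injective (by simpa using he (MulOpposite.op b))).symm
  have hz : ∀ b : A, (∀ v : X, MulOpposite.op b • v = 0) → e.unop * b = 0 := fun b hb =>
    MulOpposite.op_injective (by simpa using he0 _ hb)
  have hprim : ∀ b ∈ Subring.center A, b * b = b →
      e.unop * b = 0 ∨ e.unop * b = e.unop := by
    intro b hb hbb
    have hb' := Subring.mem_center_iff.1 hb
    -- A central element acts by a module endomorphism, so Schur's lemma applies; a bijective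
    -- idempotent is the identity.
    let φ : X →ₗ[Aᵐᵒᵖ] X :=
      { toFun := fun v => MulOpposite.op b • v
        map_add' := fun v w => smul_add _ v w
        map_smul' := fun a v => by
          simp only [RingHom.id_apply, smul_smul]
          congr 1
          exact MulOpposite.unop_injective (by simpa using hb' a.unop) }
    rcases LinearMap.bijective_or_eq_zero φ with h | h
    · right
      have h1 : ∀ v : X, MulOpposite.op b • v = v := fun v => h.1 (by
        change MulOpposite.op b • MulOpposite.op b • v = MulOpposite.op b • v
        rw [smul_smul, ← MulOpposite.op_mul, hbb])
      have := hz (b - 1) fun v => by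
        rw [MulOpposite.op_sub, sub_smul, h1, MulOpposite.op_one, one_smul, sub_self]
      rwa [mul_sub, mul_one, sub_eq_zero] at this
    · left
      exact hz b fun v => LinearMap.congr_fun h v
  have hidem : e.unop * e.unop = e.unop := by
    have := hz (e.unop - 1) fun v => by
      rw [MulOpposite.op_sub, sub_smul, MulOpposite.op_unop, heX, MulOpposite.op_one, one_smul,
        sub_self]
    rwa [mul_sub, mul_one, sub_eq_zero] at this
  have hne : ∀ b : A, (∀ v : X, MulOpposite.op b • v = v) → b ≠ 0 := by
    rintro b hb rfl
    obtain ⟨v, hv⟩ := exists_ne (0 : X)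
    exact hv (by rw [← hb v, MulOpposite.op_zero, zero_smul])
  constructor
  · rintro ⟨⟨hεc, hεi, hε0, hεp⟩, hε1⟩
    have h1 : e.unop * ε = e.unop := by
      have := hz (ε - 1) fun v => by
        rw [MulOpposite.op_sub, sub_smul, hε1, MulOpposite.op_one, one_smul, sub_self]
      rwa [mul_sub, mul_one, sub_eq_zero] at this
    have h2 : ε * e.unop = e.unop := by rw [hc, h1]
    rcases hεp e.unop (Subring.mem_center_iff.2 hc) hidem with h | h
    · exact absurd (h2.symm.trans h) (hne e.unop heX)
    · exact h.symm.trans h2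
  · rintro rfl
    exact ⟨⟨Subring.mem_center_iff.2 hc, hidem, hne e.unop heX, hprim⟩, heX⟩

end CentralIdempotent

/-! ### Galois theory for an action with kernel. -/

section FixedField

variable (K L G : Type*) [Field K] [Field L] [Algebra K L] [Group G]
  [MulSemiringAction G L] [SMulCommClass G K L]

theorem ker_toAlgAut_eq :
    (MulSemiringAction.toAlgAut G K L).ker = (MulSemiringAction.toRingAut G L).ker := by
  ext g
  simp only [MonoidHom.mem_ker]
  constructor
  · intro h
    ext w
    exact congrArg (fun φ : L ≃ₐ[K] L => φ w) h
  · intro h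
    ext w
    exact congrArg (fun φ : L ≃+* L => φ w) h

theorem trace_smul_eq (σ : G) (w : L) : Algebra.trace K L (σ • w) = Algebra.trace K L w :=
  Algebra.trace_eq_of_algEquiv (MulSemiringAction.toAlgAut G K L σ) w

theorem isGaloisGroup_range_toAlgAut [Algebra.IsInvariant K L G] :
    IsGaloisGroup (MulSemiringAction.toAlgAut G K L).range K L where
  faithful := inferInstance
  commutes := inferInstance
  isInvariant := ⟨fun b hb => Algebra.IsInvariant.isInvariant (A := K) (G := G) b fun g =>
    hb ⟨MulSemiringAction.toAlgAut G K L g, ⟨g, rfl⟩⟩⟩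

end FixedField

theorem finiteDimensional_of_isInvariant (K L G : Type*) [Field K] [Field L] [Algebra K L] [Group G] [Finite G]
    [MulSemiringAction G L] [SMulCommClass G K L] [Algebra.IsInvariant K L G] : FiniteDimensional K L :=
  have := isGaloisGroup_range_toAlgAut K L G
  have : Finite (MulSemiringAction.toAlgAut G K L).range :=
    .of_surjective _ (MulSemiringAction.toAlgAut G K L).rangeRestrict_surjective
  IsGaloisGroup.finiteDimensional (MulSemiringAction.toAlgAut G K L).range K L

theorem isGalois_of_isInvariant (K L G : Type*) [Field K] [Field L] [Algebra K L] [Group G] [Finite G]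
    [MulSemiringAction G L] [SMulCommClass G K L] [Algebra.IsInvariant K L G] : IsGalois K L :=
  have := isGaloisGroup_range_toAlgAut K L G
  have : Finite (MulSemiringAction.toAlgAut G K L).range :=
    .of_surjective _ (MulSemiringAction.toAlgAut G K L).rangeRestrict_surjective
  IsGaloisGroup.isGalois (MulSemiringAction.toAlgAut G K L).range K L

section FixedField

variable (K L G : Type*) [Field K] [Field L] [Algebra K L] [Group G] [Finite G]
  [MulSemiringAction G L] [SMulCommClass G K L] [Algebra.IsInvariant K L G]

/-- The image of `G` also has fixed field `K`, so its order is `[L : K]`, the order of the full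
automorphism group. -/
theorem toAlgAut_surjective_of_isInvariant :
    Function.Surjective (MulSemiringAction.toAlgAut G K L) := by
  have h1 := isGaloisGroup_range_toAlgAut K L G
  have := finiteDimensional_of_isInvariant K L G
  have := isGalois_of_isInvariant K L G
  rw [← MonoidHom.range_eq_top]
  apply Subgroup.eq_top_of_card_eq
  rw [IsGaloisGroup.card_eq_finrank (MulSemiringAction.toAlgAut G K L).range K L,
    IsGalois.card_aut_eq_finrank]

theorem card_eq_kernelOrder_mul_finrank :
    Nat.card G = kernelOrder L G * Module.finrank K L := by
  have := finiteDimensional_of_isInvariant K L G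
  have := isGalois_of_isInvariant K L G
  rw [kernelOrder, ← ker_toAlgAut_eq K, ← IsGalois.card_aut_eq_finrank K L,
    ← Subgroup.card_mul_index (MulSemiringAction.toAlgAut G K L).ker, Subgroup.index_ker,
    MonoidHom.range_eq_top.2 (toAlgAut_surjective_of_isInvariant K L G), Subgroup.card_top]

/-- Each automorphism of `L` over `K` comes from a coset of the kernel, hence from `n` group
elements. -/
theorem sum_smul_eq_kernelOrder_mul_trace [Fintype G] (w : L) :
    ∑ σ : G, σ • w = algebraMap K L (kernelOrder L G * Algebra.trace K L w) := by
  classical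
  have := finiteDimensional_of_isInvariant K L G
  have := isGalois_of_isInvariant K L G
  rw [map_mul, trace_eq_sum_automorphisms, Finset.mul_sum]
  have hsurj := toAlgAut_surjective_of_isInvariant K L G
  rw [← Finset.sum_fiberwise_of_maps_to (s := Finset.univ) (t := Finset.univ)
    (g := MulSemiringAction.toAlgAut G K L) (fun _ _ => Finset.mem_univ _)]
  refine Finset.sum_congr rfl fun φ _ => ?_
  have h1 : ∀ σ ∈ Finset.univ.filter (fun σ => MulSemiringAction.toAlgAut G K L σ = φ),
      σ • w = φ w := fun σ hσ => by
    rw [← (Finset.mem_filter.1 hσ).2]; rfl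
  rw [Finset.sum_congr rfl h1, Finset.sum_const, nsmul_eq_mul]
  congr 1
  rw [map_natCast, kernelOrder, ← ker_toAlgAut_eq K, ← Fintype.card_subtype,
    ← Nat.card_eq_fintype_card]
  congr 1
  obtain ⟨σ, rfl⟩ := hsurj φ
  exact Nat.card_congr ((MulSemiringAction.toAlgAut G K L).fiberEquivKer σ)

/-- The group acts transitively on the embeddings. -/
theorem exists_algHom_eq_comp_smul {Ω : Type*} [Field Ω] [Algebra K Ω] (τ τ' : L →ₐ[K] Ω) :
    ∃ σ : G, ∀ w, τ' w = τ (σ • w) := by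
  have := finiteDimensional_of_isInvariant K L G
  have := isGalois_of_isInvariant K L G
  let : Algebra L Ω := τ.toRingHom.toAlgebra
  have : IsScalarTower K L Ω := .of_algebraMap_eq fun k => (τ.commutes k).symm
  obtain ⟨σ, hσ⟩ := toAlgAut_surjective_of_isInvariant K L G (Normal.algHomEquivAut K Ω L τ')
  refine ⟨σ, fun w => ?_⟩
  have : τ' = (Normal.algHomEquivAut K Ω L).symm (MulSemiringAction.toAlgAut G K L σ) := by
    rw [hσ, Equiv.symm_apply_apply]
  rw [this]
  rfl

end FixedField

/-! ### Dual bases for the trace form of `L` over `K`. -/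

section DualBasis

variable {K L ι : Type*} [Field K] [Field L] [Algebra K L] [Fintype ι]

theorem isDualFamily_of_dualBasis [DecidableEq ι] [FiniteDimensional K L] [Algebra.IsSeparable K L]
    (y : Module.Basis ι K L) (ystar : ι → L)
    (hy : ∀ l m, Algebra.trace K L (y l * ystar m) = if l = m then 1 else 0) :
    IsDualFamily (Algebra.trace K L) y ystar where
  symm a b := by rw [mul_comm]
  expand_left a := by
    have h : ∀ m, Algebra.trace K L (a * ystar m) = y.repr a m := fun m => by
      conv_lhs => rw [← y.sum_repr a]
      simp [Finset.sum_mul, hy, -Module.Basis.sum_repr]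
    simp_rw [h]
    exact y.sum_repr a
  expand_right a := by
    rw [← sub_eq_zero]
    refine (traceForm_nondegenerate K L).1 _ fun b => ?_
    rw [Algebra.traceForm_apply, mul_comm]
    have h : ∀ l, Algebra.trace K L
        (y l * (∑ i, Algebra.trace K L (y i * a) • ystar i - a)) = 0 := fun l => by
      simp [mul_sub, Finset.mul_sum, hy]
    conv_lhs => rw [← y.sum_repr b]
    simp [Finset.sum_mul, h, -Module.Basis.sum_repr]

/-- By `trace_eq`, multiplication by `b` has trace `Tr(b * ∑ y l * ystar l)`; nondegeneracy of the
trace form does the rest. -/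
theorem sum_mul_eq_one_of_isDualFamily [FiniteDimensional K L] [Algebra.IsSeparable K L]
    {y ystar : ι → L} (h : IsDualFamily (Algebra.trace K L) y ystar) :
    ∑ l, y l * ystar l = 1 := by
  rw [← sub_eq_zero]
  refine (traceForm_nondegenerate K L).1 _ fun b => ?_
  rw [Algebra.traceForm_apply, sub_mul, map_sub, one_mul, sub_eq_zero, Finset.sum_mul, map_sum,
    Algebra.trace_apply, h.trace_eq]
  refine Finset.sum_congr rfl fun l _ => ?_
  rw [Algebra.coe_lmul_eq_mul, LinearMap.mul_apply']
  congr 1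
  ring

end DualBasis

/-! ### Restricting a representation to `L`: equal multiplicities of the embeddings. -/

section Idempotents

/-- The ranks of a complete orthogonal system of idempotent matrices add up to the size. -/
theorem sum_rank_of_completeOrthogonal {m T Ω : Type*} [Fintype m] [DecidableEq m] [Fintype T]
    [DecidableEq T] [Field Ω] (E : T → Matrix m m Ω) (h1 : ∑ τ, E τ = 1)
    (h : ∀ τ τ', E τ * E τ' = if τ = τ' then E τ' else 0) :
    ∑ τ, (E τ).rank = Fintype.card m := by
  have hmul : ∀ τ τ' v, (E τ).mulVecLin ((E τ').mulVecLin v)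
      = if τ = τ' then (E τ').mulVecLin v else 0 := fun τ τ' v => by
    rw [Matrix.mulVecLin_apply, Matrix.mulVecLin_apply, Matrix.mulVec_mulVec, h]
    split_ifs <;> simp
  let φ : (m → Ω) ≃ₗ[Ω] (∀ τ, LinearMap.range (E τ).mulVecLin) :=
    { toFun := fun v τ => ⟨(E τ).mulVecLin v, ⟨v, rfl⟩⟩
      map_add' := fun v w => by ext; simp [Matrix.mulVec_add]
      map_smul' := fun k v => by ext; simp
      invFun := fun w => ∑ τ, (w τ : m → Ω)
      left_inv := fun v => by
        have : ∑ τ, (E τ).mulVec v = v := by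
          rw [← Matrix.sum_mulVec, h1, Matrix.one_mulVec]
        simpa using this
      right_inv := fun w => by
        funext τ
        apply Subtype.ext
        change (E τ).mulVecLin (∑ τ', (w τ' : m → Ω)) = w τ
        rw [map_sum]
        have : ∀ τ', (E τ).mulVecLin (w τ') = if τ = τ' then (w τ' : m → Ω) else 0 := fun τ' => by
          obtain ⟨v, hv⟩ := (w τ').2
          rw [← hv, hmul]
        simp [this] }
  have := φ.finrank_eq
  rw [Module.finrank_fintype_fun_eq_card, Module.finrank_pi_fintype] at this
  exact this.symm

theorem trace_eq_rank_of_isIdempotentElem {m Ω : Type*} [Fintype m] [DecidableEq m] [Field Ω]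
    {E : Matrix m m Ω} (h : E * E = E) : E.trace = (E.rank : Ω) := by
  have hi : IsIdempotentElem E.mulVecLin := by
    rw [IsIdempotentElem, Module.End.mul_eq_comp, ← Matrix.mulVecLin_mul, h]
  have := (LinearMap.IsIdempotentElem.isProj_range _ hi).trace
  rw [← Matrix.toLin'_apply', Matrix.trace_toLin'_eq] at this
  exact this

end Idempotents

section Degree

variable {K L G ι : Type*} [Field K] [Field L] [Algebra K L] [Group G] [Finite G]
  [MulSemiringAction G L] [SMulCommClass G K L] [Algebra.IsInvariant K L G] [Fintype ι]

/-- A representation of `L` that is equivalent to its conjugates under the Galois group is a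
multiple of the regular representation. -/
theorem exists_multiplicity_of_conjugate {Ω m : Type*} [Field Ω] [IsAlgClosed Ω] [Algebra K Ω]
    [Fintype m] [DecidableEq m] {y ystar : ι → L}
    (hy : IsDualFamily (Algebra.trace K L) y ystar) (ρ : L →ₐ[K] Matrix m m Ω)
    (hρ : ∀ σ : G, ∃ U : (Matrix m m Ω)ˣ, ∀ w, ρ (σ • w) * U = U * ρ w) :
    ∃ r : ℕ, Fintype.card m = Module.finrank K L * r ∧
      ∀ w, (ρ w).trace = algebraMap K Ω (r * Algebra.trace K L w) := by
  classical
  have := finiteDimensional_of_isInvariant K L G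
  have := isGalois_of_isInvariant K L G
  -- `E τ` is the projector onto the subspace where `L` acts through the embedding `τ`.
  let E : (L →ₐ[K] Ω) → Matrix m m Ω := fun τ => ∑ l, τ (y l) • ρ (ystar l)
  have hE : ∀ τ w, ρ w * E τ = τ w • E τ := by
    intro τ w
    have := hy.sum_mul_left (((LinearMap.lsmul Ω (Matrix m m Ω)).restrictScalars₁₂ K K ∘ₗ
      τ.toLinearMap).compl₂ ρ.toLinearMap) w
    simp only [E, Finset.mul_sum, Finset.smul_sum, smul_smul]
    simpa [mul_comm _ w, smul_smul] using this.symm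
  have hδ : ∀ τ τ' : L →ₐ[K] Ω, ∑ l, τ (y l) * τ' (ystar l) = if τ = τ' then 1 else 0 := by
    intro τ τ'
    split_ifs with h
    · subst h
      rw [← map_one τ, ← sum_mul_eq_one_of_isDualFamily hy]
      simp
    · obtain ⟨w, hw⟩ : ∃ w, τ w ≠ τ' w := by
        by_contra! h'
        exact h (AlgHom.ext h')
      have := hy.sum_mul_left ((LinearMap.mul K Ω ∘ₗ τ.toLinearMap).compl₂ τ'.toLinearMap) w
      simp only [LinearMap.compl₂_apply, LinearMap.comp_apply, AlgHom.toLinearMap_apply,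
        LinearMap.mul_apply', map_mul] at this
      simp_rw [mul_assoc, ← mul_assoc _ (τ' _) (τ' w), ← Finset.mul_sum, ← Finset.sum_mul] at this
      rw [mul_comm, ← sub_eq_zero, ← mul_sub] at this
      exact (mul_eq_zero.1 this).resolve_right (sub_ne_zero.2 hw)
  have hEM : ∀ (τ τ' : L →ₐ[K] Ω) (M : Matrix m m Ω), (∀ w, ρ w * M = τ' w • M) →
      E τ * M = if τ = τ' then M else 0 := by
    intro τ τ' M hM
    simp only [E, Finset.sum_mul, smul_mul_assoc, hM, smul_smul, ← Finset.sum_smul, hδ]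
    split_ifs <;> simp
  have hEE : ∀ τ τ', E τ * E τ' = if τ = τ' then E τ' else 0 := fun τ τ' => hEM τ τ' _ (hE τ')
  have hsum : ∑ τ, E τ = 1 := by
    have h1 : ∑ τ, E τ = ∑ l, algebraMap K Ω (Algebra.trace K L (y l)) • ρ (ystar l) := by
      simp only [E]
      rw [Finset.sum_comm]
      refine Finset.sum_congr rfl fun l _ => ?_
      rw [trace_eq_sum_embeddings Ω, Finset.sum_smul]
    rw [h1, ← map_one ρ]
    conv_rhs => rw [← hy.expand_right 1]
    simp
  -- If `τ = τ' ∘ σ`, then the intertwiner `U` for `σ` carries the `τ`-eigenspace into the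
  -- `τ'`-eigenspace.
  have hrank_le : ∀ τ τ', (E τ).rank ≤ (E τ').rank := by
    intro τ τ'
    obtain ⟨σ, hσ⟩ := exists_algHom_eq_comp_smul K L G τ' τ
    obtain ⟨U, hU⟩ := hρ σ
    have hM : ∀ w, ρ w * (U * E τ) = τ' w • (U * E τ) := by
      intro w
      have := hU (σ⁻¹ • w)
      rw [smul_inv_smul] at this
      rw [← mul_assoc, this, mul_assoc, hE, hσ, smul_inv_smul, mul_smul_comm]
    have h2 := hEM τ' τ' _ hM
    rw [if_pos rfl] at h2
    calc (E τ).rank = ((U : Matrix m m Ω) * E τ).rank :=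
          (Matrix.rank_mul_eq_right_of_isUnit_det _ _
            ((Matrix.isUnit_iff_isUnit_det _).1 U.isUnit)).symm
      _ = (E τ' * (U * E τ)).rank := by rw [h2]
      _ ≤ (E τ').rank := Matrix.rank_mul_le_left _ _
  obtain ⟨τ₀⟩ : Nonempty (L →ₐ[K] Ω) := ⟨IsAlgClosed.lift⟩
  have hrank : ∀ τ, (E τ).rank = (E τ₀).rank := fun τ => le_antisymm (hrank_le _ _) (hrank_le _ _)
  refine ⟨(E τ₀).rank, ?_, fun w => ?_⟩
  · rw [← sum_rank_of_completeOrthogonal E hsum hEE]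
    simp [hrank, AlgHom.card]
  · have h1 : ρ w = ∑ τ, τ w • E τ := by
      rw [← mul_one (ρ w), ← hsum, Finset.mul_sum]
      simp_rw [hE]
    have h2 : ∀ τ, (E τ).trace = ((E τ₀).rank : Ω) := fun τ => by
      rw [trace_eq_rank_of_isIdempotentElem ((hEE τ τ).trans (if_pos rfl)), hrank]
    rw [h1, Matrix.trace_sum, map_mul, trace_eq_sum_embeddings Ω, map_natCast, Finset.mul_sum]
    refine Finset.sum_congr rfl fun τ _ => ?_
    rw [Matrix.trace_smul, h2, smul_eq_mul, mul_comm]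

end Degree

theorem IsDualFamily.finiteDimensional {K R ι : Type*} [Field K] [Ring R] [Algebra K R] [Fintype ι]
    {f : R →ₗ[K] K} {p q : ι → R} (h : IsDualFamily f p q) : FiniteDimensional K R := by
  refine ⟨⟨(Set.finite_range p).toFinset, ?_⟩⟩
  rw [Set.Finite.coe_toFinset, eq_top_iff]
  intro a _
  rw [← h.expand_left a]
  exact Submodule.sum_mem _ fun i _ => Submodule.smul_mem _ _ (Submodule.subset_span ⟨i, rfl⟩)

/-- The trace is the sum of the eigenvalues, and these are roots of every monic polynomial that
kills `M`. -/
theorem isIntegral_matrix_trace {S Ω m : Type*} [CommRing S] [Field Ω] [IsAlgClosed Ω]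
    [Algebra S Ω] [Fintype m] [DecidableEq m] {M : Matrix m m Ω} (h : IsIntegral S M) :
    IsIntegral S M.trace := by
  rw [Matrix.trace_eq_sum_roots_charpoly]
  refine IsIntegral.multiset_sum fun μ hμ => ?_
  have hμ' := Matrix.mem_spectrum_of_isRoot_charpoly (Polynomial.isRoot_of_mem_roots hμ)
  obtain ⟨p, hp, hpM⟩ := h
  refine ⟨p, hp, ?_⟩
  have hpM' : Polynomial.aeval M (p.map (algebraMap S Ω)) = 0 := by
    rw [Polynomial.aeval_map_algebraMap]; exact hpM
  have : Nontrivial (Matrix m m Ω) := by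
    by_contra hn
    rw [not_nontrivial_iff_subsingleton] at hn
    rw [spectrum.of_subsingleton] at hμ'
    exact hμ'
  have h2 := spectrum.subset_polynomial_aeval M (p.map (algebraMap S Ω)) ⟨μ, hμ', rfl⟩
  rw [hpM', spectrum.zero_eq, Set.mem_singleton_iff] at h2
  rwa [← Polynomial.eval_map]

/-! ### The trace form of the twisted group ring. -/

section TwistedGroupRing

open SkewMonoidAlgebra MulOpposite

variable (K L G : Type*) [Field K] [Field L] [Algebra K L] [Group G]
  [MulSemiringAction G L] [SMulCommClass G K L]

/-- The trace form on the twisted group ring, on the opposite ring. -/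
noncomputable def twistedTraceForm : (TwistedGroupRing L G)ᵐᵒᵖ →ₗ[K] K where
  toFun a := Algebra.trace K L (a.unop.coeff 1)
  map_add' a b := by simp
  map_smul' k a := by simp

/-- The inclusion of the coefficient field into the opposite of the twisted group ring. -/
noncomputable def coeffAlgHom : L →ₐ[K] (TwistedGroupRing L G)ᵐᵒᵖ where
  toFun w := op (single 1 w)
  map_one' := rfl
  map_mul' v w := by rw [← op_mul, single_mul_single, one_smul, one_mul, mul_comm]
  map_zero' := by simp
  map_add' v w := by rw [single_add, op_add]
  commutes' k := rfl

variable {K L G}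

theorem sum_single_coeff [Fintype G] (a : TwistedGroupRing L G) :
    ∑ σ : G, (single σ (a.coeff σ) : TwistedGroupRing L G) = a := by
  classical
  refine SkewMonoidAlgebra.induction_on a (by simp) (fun τ z => ?_) fun a b ha hb => ?_
  · rw [Finset.sum_eq_single τ]
    · simp
    · intro σ _ h
      rw [coeff_single_apply, if_neg (Ne.symm h), single_zero]
    · simp
  · simp only [coeff_add, Finsupp.add_apply, single_add, Finset.sum_add_distrib, ha, hb]

theorem twistedTraceForm_mul_comm (a b : (TwistedGroupRing L G)ᵐᵒᵖ) :
    twistedTraceForm K L G (a * b) = twistedTraceForm K L G (b * a) := by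
  classical
  induction a using MulOpposite.rec' with | _ a => ?_
  induction b using MulOpposite.rec' with | _ b => ?_
  simp only [twistedTraceForm, LinearMap.coe_mk, AddHom.coe_mk, ← op_mul, unop_op]
  refine SkewMonoidAlgebra.induction_on a (by simp) (fun σ z => ?_) fun a a' ha ha' => ?_
  · rw [coeff_single_mul, coeff_mul_single, one_mul, mul_one, ← trace_smul_eq K L G σ (_ * _),
      smul_mul', smul_inv_smul, mul_comm]
  · simp only [mul_add, add_mul, coeff_add, Finsupp.add_apply, map_add, ha, ha']

theorem isDualFamily_twistedTraceForm {ι : Type*} [Fintype ι] [Fintype G] {y ystar : ι → L}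
    (hy : IsDualFamily (Algebra.trace K L) y ystar) :
    IsDualFamily (twistedTraceForm K L G) (fun i : G × ι => op (single i.1 (i.1 • y i.2)))
      (fun i => op (single i.1⁻¹ (ystar i.2))) where
  symm := twistedTraceForm_mul_comm
  expand_left a := by
    apply unop_injective
    conv_rhs => rw [← sum_single_coeff a.unop]
    rw [Finset.unop_sum, ← Finset.univ_product_univ, Finset.sum_product]
    refine Finset.sum_congr rfl fun σ _ => ?_
    conv_rhs => rw [← smul_inv_smul σ (a.unop.coeff σ), ← hy.expand_left (σ⁻¹ • a.unop.coeff σ)]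
    simp only [twistedTraceForm, LinearMap.coe_mk, AddHom.coe_mk, unop_mul, unop_op, unop_smul,
      coeff_single_mul, inv_inv, mul_one, Finset.smul_sum, smul_single, smul_comm σ]
    have h := _root_.map_sum (singleAddHom (k := L) σ)
      (fun l => Algebra.trace K L (ystar l * σ⁻¹ • a.unop.coeff σ) • σ • y l) Finset.univ
    simp only [mul_comm (ystar _)] at h ⊢
    exact h.symm
  expand_right a := by
    apply unop_injective
    conv_rhs => rw [← sum_single_coeff a.unop]
    rw [← Fintype.sum_equiv (Equiv.inv G) (fun σ => single σ⁻¹ (a.unop.coeff σ⁻¹))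
      (fun σ => single σ (a.unop.coeff σ)) fun _ => rfl]
    rw [Finset.unop_sum, ← Finset.univ_product_univ, Finset.sum_product]
    refine Finset.sum_congr rfl fun σ _ => ?_
    conv_rhs => rw [← hy.expand_right (a.unop.coeff σ⁻¹)]
    simp only [twistedTraceForm, LinearMap.coe_mk, AddHom.coe_mk, unop_mul, unop_op, unop_smul,
      coeff_mul_single, one_mul, inv_smul_smul, smul_single]
    have h := _root_.map_sum (singleAddHom (k := L) σ⁻¹)
      (fun l => Algebra.trace K L (y l * a.unop.coeff σ⁻¹) • ystar l) Finset.univ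
    simp only [mul_comm (y _)] at h ⊢
    exact h.symm

/-- The term at `(σ, l)` is `y l * ystar l * σ⁻¹ • w`. Summing over `l` removes the dual basis, and
summing over `σ` gives `n Tr(w)`. -/
theorem sum_mul_coeffAlgHom_mul [Fintype G] [Algebra.IsInvariant K L G] {ι : Type*} [Fintype ι]
    {y ystar : ι → L} (hy : IsDualFamily (Algebra.trace K L) y ystar) (w : L) :
    ∑ i : G × ι, op (single i.1 (i.1 • y i.2)) * coeffAlgHom K L G w *
        op (single i.1⁻¹ (ystar i.2))
      = algebraMap K (TwistedGroupRing L G)ᵐᵒᵖ (kernelOrder L G * Algebra.trace K L w) := by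
  have := finiteDimensional_of_isInvariant K L G
  have := isGalois_of_isInvariant K L G
  have h1 : ∀ (σ : G) (l : ι), op (single σ (σ • y l)) * coeffAlgHom K L G w *
      op (single σ⁻¹ (ystar l)) = coeffAlgHom K L G ((y l * ystar l) * σ⁻¹ • w) := fun σ l => by
    change op (single σ (σ • y l)) * op (single 1 w) * op (single σ⁻¹ (ystar l)) = op _
    rw [← op_mul, ← op_mul, single_mul_single, single_mul_single, one_smul, one_mul,
      inv_mul_cancel, smul_mul', inv_smul_smul]
    congr 2
    ring
  rw [← Finset.univ_product_univ, Finset.sum_product]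
  simp only [h1, ← _root_.map_sum, ← Finset.sum_mul, sum_mul_eq_one_of_isDualFamily hy, one_mul]
  rw [Fintype.sum_equiv (Equiv.inv G) (fun σ => σ⁻¹ • w) (fun σ => σ • w) fun _ => rfl,
    sum_smul_eq_kernelOrder_mul_trace K, AlgHom.commutes]

end TwistedGroupRing

/-! ### Integrality of the character and the two computations of the trace. -/

section Multiplicity

open SkewMonoidAlgebra MulOpposite

variable {S K L G : Type*} [CommRing S] [Field K] [Field L] [Algebra S K] [Algebra K L]
  [Algebra S L] [IsScalarTower S K L] [Group G] [MulSemiringAction G L] [SMulCommClass G K L]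

theorem isIntegral_smul_of_group (K : Type*) [Field K] [Algebra S K] [Algebra K L]
    [IsScalarTower S K L] [SMulCommClass G K L] (σ : G) {z : L} (hz : IsIntegral S z) :
    IsIntegral S (σ • z) :=
  hz.map ((MulSemiringAction.toAlgAut G K L σ).toAlgHom.restrictScalars S)

theorem single_pow_eq (σ : G) (z : L) (k : ℕ) :
    (single σ z : TwistedGroupRing L G) ^ k
      = single (σ ^ k) (∏ i ∈ Finset.range k, σ ^ i • z) := by
  induction k with
  | zero => rw [pow_zero, pow_zero, Finset.range_zero, Finset.prod_empty]; rfl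
  | succ k ih => rw [pow_succ, ih, single_mul_single, Finset.prod_range_succ, pow_succ]

/-- Raised to the order of `σ`, the element becomes a product of conjugates of `z`, placed at `1`.
-/
theorem isIntegral_map_single [Finite G] {M : Type*} [Ring M] [Algebra K M] [Algebra S M]
    [IsScalarTower S K M] (ρ : (TwistedGroupRing L G)ᵐᵒᵖ →ₐ[K] M) (σ : G) {z : L}
    (hz : IsIntegral S z) : IsIntegral S (ρ (op (single σ z))) := by
  refine IsIntegral.of_pow (orderOf_pos σ) ?_
  rw [← map_pow, ← op_pow, single_pow_eq, pow_orderOf_eq_one]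
  exact (IsIntegral.prod _ fun i _ => isIntegral_smul_of_group K (σ ^ i) hz).map
    ((ρ.comp (coeffAlgHom K L G)).restrictScalars S)

/-- The character of the simple module `X`, restricted to `L`, is `r` times the trace, where
`x d = h r`; and `(n / r) ε` is integral with respect to the trace form. -/
theorem exists_multiplicity_and_isIntegral [Finite G] [Algebra.IsInvariant K L G]
    {ι : Type*} [Fintype ι] {y ystar : ι → L} (hy : IsDualFamily (Algebra.trace K L) y ystar)
    (hn : (kernelOrder L G : K) ≠ 0) (X : Type u) [AddCommGroup X]
    [Module (TwistedGroupRing L G)ᵐᵒᵖ X] [IsSimpleModule (TwistedGroupRing L G)ᵐᵒᵖ X]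
    {e : (TwistedGroupRing L G)ᵐᵒᵖ} (he : ∀ a, a * e = e * a)
    (heX : ∀ v : X, e • v = v)
    (he0 : ∀ a : (TwistedGroupRing L G)ᵐᵒᵖ, (∀ v : X, a • v = 0) → a * e = 0) :
    ∃ r : ℕ, dimOverEnd (TwistedGroupRing L G) X *
        skewFieldDegree (EndRight (TwistedGroupRing L G) X) = Module.finrank K L * r ∧
      (r : K) ≠ 0 ∧ ∀ (σ : G) (z : L), IsIntegral S z →
        IsIntegral S ((kernelOrder L G / r : K) * twistedTraceForm K L G (op (single σ z) * e)) := by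
  classical
  cases nonempty_fintype G
  have := finiteDimensional_of_isInvariant K L G
  have := isGalois_of_isInvariant K L G
  have hdual := isDualFamily_twistedTraceForm (G := G) hy
  have := hdual.finiteDimensional
  obtain ⟨Z, Ω, _, _, _, _, _, _, _, _, ρ, hρ⟩ :=
    exists_character_of_isSimpleModule (K := K) X he heX he0
  obtain ⟨r, hr, hχ⟩ := exists_multiplicity_of_conjugate (G := G) hy
    (ρ.comp (coeffAlgHom K L G)) fun σ => by
      -- The group elements, being units of the ring, intertwine the conjugates. The inverse of `σ`
      -- appears because of the opposite multiplication.
      refine ⟨⟨ρ (op (single σ⁻¹ 1)), ρ (op (single σ 1)), ?_, ?_⟩, fun w => ?_⟩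
      · rw [← map_mul, ← op_mul, single_mul_single, mul_inv_cancel, smul_one, mul_one]
        exact map_one ρ
      · rw [← map_mul, ← op_mul, single_mul_single, inv_mul_cancel, smul_one, mul_one]
        exact map_one ρ
      · change ρ (op (single 1 (σ • w))) * ρ _ = ρ _ * ρ (op (single 1 w))
        rw [← map_mul, ← map_mul, ← op_mul, ← op_mul, single_mul_single, single_mul_single,
          inv_smul_smul, one_smul, one_mul, mul_one, one_mul, mul_one]
  have htr : ∀ (a : (TwistedGroupRing L G)ᵐᵒᵖ) (w : L),
      LinearMap.trace K _ (LinearMap.mulLeftRight K (a, coeffAlgHom K L G w * e))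
        = (kernelOrder L G * Algebra.trace K L w) * twistedTraceForm K L G (a * e) := by
    intro a w
    have h1 : ∀ p q : (TwistedGroupRing L G)ᵐᵒᵖ,
        LinearMap.mulLeftRight K (a, coeffAlgHom K L G w * e) p * q
          = a * (p * coeffAlgHom K L G w * q) * e := fun p q => by
      simp only [LinearMap.mulLeftRight_apply, mul_assoc, he q]
    rw [hdual.trace_eq]
    simp only [h1]
    rw [← _root_.map_sum, ← Finset.sum_mul, ← Finset.mul_sum, sum_mul_coeffAlgHom_mul hy,
      mul_assoc, ← Algebra.smul_def, mul_smul_comm, map_smul, smul_eq_mul]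
  -- If `r = 0` in `K`, the character vanishes on `L`. With `Tr(w) = 1/n` the trace identity gives
  -- `f(a e) = 0` for all `a`, hence `e = 0`, although `e` acts as the identity on `X ≠ 0`.
  have hr0 : (r : K) ≠ 0 := by
    intro h0
    obtain ⟨w, hw⟩ := Algebra.trace_surjective K L (kernelOrder L G : K)⁻¹
    have hf : ∀ a, twistedTraceForm K L G (a * e) = 0 := by
      intro a
      obtain ⟨z, hz, hz'⟩ := hρ a (coeffAlgHom K L G w)
      have h2 : (ρ (coeffAlgHom K L G w)).trace = 0 := by
        have := hχ w
        rwa [h0, zero_mul, map_zero] at this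
      rw [h2, mul_zero, map_eq_zero] at hz
      rw [hz, map_zero, htr, hw, mul_inv_cancel₀ hn, one_mul] at hz'
      exact hz'.symm
    have he00 : e = 0 := by
      rw [← hdual.expand_right e]
      exact Finset.sum_eq_zero fun i _ => by rw [hf, zero_smul]
    have : Nontrivial X := IsSimpleModule.nontrivial (TwistedGroupRing L G)ᵐᵒᵖ X
    obtain ⟨v, hv⟩ := exists_ne (0 : X)
    exact hv (by rw [← heX v, he00, zero_smul])
  rw [Fintype.card_fin] at hr
  refine ⟨r, hr, hr0, fun σ z hz => ?_⟩
  -- This `w` has character value `1`, so `c` maps to the character value of `single σ z` alone.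
  obtain ⟨w, hw⟩ := Algebra.trace_surjective K L (r : K)⁻¹
  obtain ⟨c, hc, hc'⟩ := hρ (op (single σ z)) (coeffAlgHom K L G w)
  have h2 : (ρ (coeffAlgHom K L G w)).trace = 1 := by
    have := hχ w
    rwa [hw, mul_inv_cancel₀ hr0, map_one] at this
  rw [h2, mul_one] at hc
  rw [htr, hw, ← div_eq_mul_inv] at hc'
  rw [← hc']
  let : Algebra S Ω := ((algebraMap K Ω).comp (algebraMap S K)).toAlgebra
  let : Algebra S Z := ((algebraMap K Z).comp (algebraMap S K)).toAlgebra
  have : IsScalarTower S K Ω := .of_algebraMap_eq fun _ => rfl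
  have : IsScalarTower S K Z := .of_algebraMap_eq fun _ => rfl
  have : IsScalarTower S Z Ω := .of_algebraMap_eq fun s =>
    IsScalarTower.algebraMap_apply K Z Ω (algebraMap S K s)
  have hci : IsIntegral S c := by
    rw [← isIntegral_algebraMap_iff (algebraMap Z Ω).injective, hc]
    exact isIntegral_matrix_trace (isIntegral_map_single ρ σ hz)
  exact Algebra.isIntegral_trace hci

end Multiplicity

/-! ### Elements with coefficients in `T`. -/

section Integrality

open SkewMonoidAlgebra MulOpposite

variable {S K L G : Type*} [CommRing S] [Field K] [Field L] [Algebra S K] [Algebra K L]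
  [Algebra S L] [IsScalarTower S K L] [Group G] [MulSemiringAction G L] [SMulCommClass G K L]

theorem single_mem_integralTwistedGroupRing (σ : G) {z : L} (hz : IsIntegral S z) :
    single σ z ∈ integralTwistedGroupRing S L G := by
  classical
  intro τ
  rw [coeff_single_apply]
  split_ifs
  · exact hz
  · exact Subalgebra.zero_mem _

theorem mul_mem_integralTwistedGroupRing [Finite G] {a b : TwistedGroupRing L G}
    (K : Type*) [Field K] [Algebra S K] [Algebra K L] [IsScalarTower S K L] [SMulCommClass G K L]
    (ha : a ∈ integralTwistedGroupRing S L G) (hb : b ∈ integralTwistedGroupRing S L G) :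
    a * b ∈ integralTwistedGroupRing S L G := by
  cases nonempty_fintype G
  rw [← sum_single_coeff a, ← sum_single_coeff b, Finset.sum_mul_sum]
  refine Submodule.sum_mem _ fun σ _ => Submodule.sum_mem _ fun τ _ => ?_
  rw [single_mul_single]
  exact single_mem_integralTwistedGroupRing _ ((ha σ).mul (isIntegral_smul_of_group K σ (hb τ)))

instance isScalarTower_twistedGroupRing : IsScalarTower S K (TwistedGroupRing L G) :=
  ⟨fun s k a => by ext; simp⟩

/-- A scalar multiple of a nonzero idempotent can have integral coefficients only if the scalar is
integral. -/
theorem isIntegral_of_smul_idempotent_mem [Finite G] [Module.Finite S (integralClosure S L)]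
    {e : TwistedGroupRing L G} (he : e * e = e) (he0 : e ≠ 0) {k : K}
    (hk : k • e ∈ integralTwistedGroupRing S L G) : IsIntegral S k := by
  cases nonempty_fintype G
  -- The range of `φ` is `(T ≀ G) e`, a nonzero finitely generated `S`-module. It is stable under
  -- `k`, because `k • (c * e) = (c * (k • e)) * e`.
  let φ : (G → integralClosure S L) →ₗ[S] TwistedGroupRing L G :=
    { toFun := fun c => ∑ σ, single σ (c σ : L) * e
      map_add' := fun c c' => by
        simp [single_add, add_mul, Finset.sum_add_distrib]
      map_smul' := fun s c => by
        rw [RingHom.id_apply, Finset.smul_sum]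
        refine Finset.sum_congr rfl fun σ _ => ?_
        rw [← IsScalarTower.algebraMap_smul K s (single σ (c σ : L) * e), ← smul_mul_assoc,
          IsScalarTower.algebraMap_smul K s, smul_single]
        rfl }
  have hφ : ∀ a ∈ integralTwistedGroupRing S L G, a * e ∈ LinearMap.range φ := fun a ha =>
    ⟨fun σ => ⟨a.coeff σ, ha σ⟩, by
      change ∑ σ, single σ (a.coeff σ) * e = _
      rw [← Finset.sum_mul, sum_single_coeff]⟩
  refine isIntegral_of_smul_mem_submodule (M := TwistedGroupRing L G) (LinearMap.range φ) ?_
    (Module.Finite.fg_top.map φ |> fun h => by rwa [Submodule.map_top] at h) k ?_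
  · intro hbot
    have h1 : (1 : TwistedGroupRing L G) * e ∈ LinearMap.range φ :=
      hφ 1 (single_mem_integralTwistedGroupRing 1 isIntegral_one)
    rw [hbot, one_mul, Submodule.mem_bot] at h1
    exact he0 h1
  · rintro _ ⟨c, rfl⟩
    have h1 : k • φ c = ((∑ σ, single σ (c σ : L)) * (k • e)) * e := by
      change k • ∑ σ, single σ (c σ : L) * e = _
      rw [← Finset.sum_mul, mul_smul_comm, smul_mul_assoc, mul_assoc, he]
    rw [h1]
    exact hφ _ (mul_mem_integralTwistedGroupRing K
      (Submodule.sum_mem _ fun σ _ => single_mem_integralTwistedGroupRing σ (c σ).2) hk)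

/-- The expansion of an element with integral traces with respect to the dual basis. -/
theorem smul_mem_integralTwistedGroupRing [IsIntegrallyClosed S] [IsDomain S] [IsFractionRing S K]
    [Fintype G] {ι : Type*} [Fintype ι] {y ystar : ι → L}
    (hy : IsDualFamily (Algebra.trace K L) y ystar) (hyint : ∀ l, IsIntegral S (y l)) {s : S}
    (hs : ∀ l, s • ystar l ∈ integralClosure S L) {k : K} {e : (TwistedGroupRing L G)ᵐᵒᵖ}
    (h : ∀ (σ : G) (z : L), IsIntegral S z →
      IsIntegral S (k * twistedTraceForm K L G (op (single σ z) * e))) :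
    (algebraMap S K s * k) • e.unop ∈ integralTwistedGroupRing S L G := by
  have hdual := isDualFamily_twistedTraceForm (G := G) hy
  have h1 : (algebraMap S K s * k) • e.unop = ∑ i : G × ι,
      (k * twistedTraceForm K L G (op (single i.1 (i.1 • y i.2)) * e)) •
        (single i.1⁻¹ (s • ystar i.2) : TwistedGroupRing L G) := by
    conv_lhs => rw [← hdual.expand_right e]
    rw [Finset.unop_sum, Finset.smul_sum]
    refine Finset.sum_congr rfl fun i _ => ?_
    generalize twistedTraceForm K L G _ = c
    rw [unop_smul, unop_op, ← smul_single s, ← IsScalarTower.algebraMap_smul K s, smul_smul,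
      smul_smul]
    congr 1
    ring
  rw [h1]
  refine Submodule.sum_mem _ fun i _ => ?_
  -- The coefficient lies in `K` and is integral, hence lies in `S`; the factor `s` moves `ystar`
  -- into `T`.
  obtain ⟨c, hc⟩ := IsIntegrallyClosed.isIntegral_iff.1
    (h i.1 (i.1 • y i.2) (isIntegral_smul_of_group K _ (hyint i.2)))
  rw [← hc, IsScalarTower.algebraMap_smul]
  exact Submodule.smul_mem _ _ (single_mem_integralTwistedGroupRing _ (hs i.2))

end Integrality

/-! ### Passage to fraction fields and the main theorem. -/

section Localization

open scoped nonZeroDivisors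

/-- A basis of the integral closure is a basis of the extension of fraction fields. -/
theorem exists_basis_of_basis_integralClosure {S K L ι : Type*} [CommRing S] [IsDomain S]
    [Field K] [Field L] [Algebra S K] [IsFractionRing S K] [Algebra K L] [Algebra S L]
    [IsScalarTower S K L] [FiniteDimensional K L]
    (y : Module.Basis ι S (integralClosure S L)) :
    ∃ b : Module.Basis ι K L, ∀ l, b l = (y l : L) := by
  have := IsIntegralClosure.isLocalization S K L (integralClosure S L)
  exact ⟨y.localizationLocalization K S⁰ L, fun l => y.localizationLocalization_apply K S⁰ L l⟩

end Localization

theorem mainTheorem10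
    {S K L G : Type*} [CommRing S] [IsDomain S] [IsDiscreteValuationRing S]
    [Field K] [Field L] [Algebra S K] [IsFractionRing S K] [Algebra K L] [Algebra S L]
    [IsScalarTower S K L] [Group G] [Finite G] [MulSemiringAction G L]
    -- `K` is the fixed field of `G` in `L`
    [SMulCommClass G K L] [Algebra.IsInvariant K L G]
    -- the order of the kernel of the action is invertible in `K`
    (hn : (kernelOrder L G : K) ≠ 0)
    (π : S) (hπ : Irreducible π)
    -- an `S`-linear basis of `T`, and its dual basis with respect to the trace form
    {ι : Type*} [Fintype ι] [DecidableEq ι]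
    (y : Module.Basis ι S (integralClosure S L)) (ystar : ι → L)
    (hystar : ∀ l m, Algebra.trace K L ((y l : L) * ystar m) = if l = m then 1 else 0)
    (t : ℕ)
    (ht : ∀ z : S, z ∈ Ideal.span {π ^ t} ↔ ∀ l, z • ystar l ∈ integralClosure S L)
    -- a simple right module over the twisted group ring
    (X : Type*) [AddCommGroup X] [Module (TwistedGroupRing L G)ᵐᵒᵖ X]
    [IsSimpleModule (TwistedGroupRing L G)ᵐᵒᵖ X]
    (g n h x d : ℕ) (hg : g = Nat.card G) (hn' : n = kernelOrder L G)
    (hh : h = Module.finrank K L)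
    (hx : x = dimOverEnd (TwistedGroupRing L G) X)
    (hd : d = skewFieldDegree (EndRight (TwistedGroupRing L G) X)) :
    -- the bound, for the `π`-adic valuation with `v(0) = ∞`
    IsDiscreteValuationRing.addVal S (x : S) + IsDiscreteValuationRing.addVal S (d : S)
        ≤ IsDiscreteValuationRing.addVal S (g : S) + t ∧
    -- the quotient `g / (x d) = n / (x d / h)` makes sense in `K`
    (h ∣ x * d ∧ ((x * d / h : ℕ) : K) ≠ 0) ∧
    -- the bound with the common factor `h` removed
    IsDiscreteValuationRing.addVal S ((x * d / h : ℕ) : S)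
        ≤ IsDiscreteValuationRing.addVal S (n : S) + t ∧
    -- `(π ^ t g / (x d)) ε ∈ T ≀ G` for the central primitive idempotent `ε` of `X`
    (∃! ε : TwistedGroupRing L G, IsCentralPrimitiveIdempotentOf X ε) ∧
    ∀ ε : TwistedGroupRing L G, IsCentralPrimitiveIdempotentOf X ε →
      (algebraMap S K π ^ t * ((n : K) / ((x * d / h : ℕ) : K))) • ε
        ∈ integralTwistedGroupRing S L G := by
  classical
  cases nonempty_fintype G
  have := finiteDimensional_of_isInvariant K L G
  have := isGalois_of_isInvariant K L G
  obtain ⟨b, hb⟩ := exists_basis_of_basis_integralClosure (K := K) y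
  have hy : IsDualFamily (Algebra.trace K L) b ystar :=
    isDualFamily_of_dualBasis b ystar fun l m => by rw [hb, hystar]
  obtain ⟨w, hw⟩ := Algebra.trace_surjective K L (kernelOrder L G : K)⁻¹
  obtain ⟨e, he, heX, he0⟩ := (isDualFamily_twistedTraceForm (G := G) hy
    ).exists_central_idempotent_of_module (w := coeffAlgHom K L G w)
    (by rw [sum_mul_coeffAlgHom_mul hy, hw, mul_inv_cancel₀ hn, map_one]) X
  have hiff := isCentralPrimitiveIdempotentOf_iff X he heX he0
  obtain ⟨r, hxd, hr0, hint⟩ := exists_multiplicity_and_isIntegral (S := S) hy hn X he heX he0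
  rw [← hx, ← hd, ← hh] at hxd
  have hh0 : 0 < h := hh ▸ Module.finrank_pos
  have hdiv : x * d / h = r := by rw [hxd, Nat.mul_div_cancel_left r hh0]
  have hmem : (algebraMap S K π ^ t * ((n : K) / (r : K))) • e.unop
      ∈ integralTwistedGroupRing S L G := by
    rw [hn', ← map_pow]
    exact smul_mem_integralTwistedGroupRing hy (fun l => hb l ▸ (y l).2)
      ((ht (π ^ t)).1 (Ideal.mem_span_singleton_self _)) hint
  have hε := ((hiff e.unop).2 rfl).isCentralPrimitiveIdempotent
  have : Module.Finite S (integralClosure S L) := .of_basis y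
  obtain ⟨z, hz⟩ := IsIntegrallyClosed.isIntegral_iff.1
    (isIntegral_of_smul_idempotent_mem hε.idempotent hε.ne_zero hmem)
  -- Integrality of `π ^ t * n / r` over `S` becomes divisibility of `π ^ t * n` by `r`.
  have hzr : z * (r : S) = π ^ t * (n : S) := by
    apply IsFractionRing.injective S K
    rw [map_mul, hz, map_mul, map_pow, map_natCast, map_natCast, mul_assoc, div_mul_cancel₀ _ hr0]
  have hbound : IsDiscreteValuationRing.addVal S (r : S)
      ≤ IsDiscreteValuationRing.addVal S (n : S) + t := by
    rw [add_comm, ← hπ.addVal_pow t, ← IsDiscreteValuationRing.addVal_mul, ← hzr,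
      IsDiscreteValuationRing.addVal_le_iff_dvd]
    exact Dvd.intro_left z rfl
  rw [hdiv]
  refine ⟨?_, ⟨⟨r, hxd⟩, hr0⟩, hbound, ⟨e.unop, (hiff _).2 rfl, fun ε h => (hiff ε).1 h⟩,
    fun ε h => (hiff ε).1 h ▸ hmem⟩
  -- Both sides of the first bound gain the summand `v(h)`. Adding it is harmless even when it is
  -- infinite, whereas it could not be cancelled.
  have hgnh : g = n * h := by rw [hg, hn', hh, card_eq_kernelOrder_mul_finrank K L G]
  rw [← IsDiscreteValuationRing.addVal_mul, ← Nat.cast_mul, hxd, hgnh, Nat.cast_mul, Nat.cast_mul,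
    IsDiscreteValuationRing.addVal_mul, IsDiscreteValuationRing.addVal_mul,
    add_comm (IsDiscreteValuationRing.addVal S (n : S)), add_assoc]
  gcongr
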